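/- Let $F(a,b;c;z)=\sum_{n\ge 0}\frac{(a)_n(b)_n}{(c)_n}\frac{z^n}{n!}$ $(|z|<1)$ denote the Gauss hypergeometric function, where $(a)_n=a(a+1)\cdots(a+n-1)$. There is exactly one increasing bijection $(0,1)\to(0,1)$, $x\mapsto\xi$, such that for all $x\in(0,1)$ $$4\xi(1-\xi)=\frac{27}{4}\,\frac{x^2(1-x)^2}{(1-x+x^2)^3},$$ and for this bijection the identity $$F\left(\tfrac16,\tfrac56;1;\xi\right)=(1-x+x^2)^{1/4}\,F\left(\tfrac12,\tfrac12;1;x\right)$$ holds for every $x\in(0,1)$. -/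

import Mathlib

/-- `ξ` is an increasing bijection of the open unit interval `(0, 1)` onto itself that satisfies
`4 ξ (1 - ξ) = (27 / 4) x² (1 - x)² / (1 - x + x²)³` for every `x` in `(0, 1)`. -/
structure IsSexticModulusMap (ξ : Set.Ioo (0 : ℝ) 1 → Set.Ioo (0 : ℝ) 1) : Prop where
  strictMono : StrictMono ξ
  bijective : Function.Bijective ξ
  modular_eq : ∀ x : Set.Ioo (0 : ℝ) 1,
    4 * (ξ x : ℝ) * (1 - (ξ x : ℝ)) =
      (27 / 4 : ℝ) * ((x : ℝ) ^ 2 * (1 - (x : ℝ)) ^ 2 / (1 - (x : ℝ) + (x : ℝ) ^ 2) ^ 3)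

open Set Filter Topology

/-! Write T = (1 - x + x²)^(1/4). The modular equation is quadratic in ξ and has an explicit
increasing root with x(1-x)ξ' = 2T²ξ(1-ξ). This relation makes F(1/6,5/6;1;ξ)/T a solution of
(x(1-x)u')' = u/4, the equation of F(1/2,1/2;1;x)
(`hasDerivAt_ordinaryHypergeometric_one_selfAdjoint`). Both solutions are regular at the singular
point 0 with value 1, so x(1-x) times their Wronskian is constant and vanishes at 0, and they
coincide (`eq_of_selfAdjoint_equation`). -/

theorem summable_mul_pow_of_abs_le {c : ℕ → ℝ} {C z : ℝ} {k : ℕ}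
    (hc : ∀ n, |c n| ≤ C * ((n : ℝ) + 1) ^ k) (hz : |z| < 1) : Summable fun n => c n * z ^ n := by
  have h1 : Summable fun n : ℕ => C * (((n + 1 : ℕ) : ℝ) ^ k * |z| ^ n) := by
    by_cases h0 : z = 0
    · subst h0
      refine summable_of_ne_finset_zero (s := {0}) fun n hn => ?_
      have : n ≠ 0 := by simpa using hn
      simp [this]
    · have h := (summable_nat_add_iff 1).2
        (summable_pow_mul_geometric_of_norm_lt_one (R := ℝ) k (r := |z|) (by simpa using hz))
      refine Summable.mul_left C ?_
      refine (h.mul_right |z|⁻¹).congr fun n => ?_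
      have : |z| ≠ 0 := by simpa using h0
      rw [pow_succ]
      field_simp
  refine Summable.of_norm_bounded h1 fun n => ?_
  rw [norm_mul, norm_pow, Real.norm_eq_abs, Real.norm_eq_abs, ← mul_assoc]
  have := hc n
  push_cast
  gcongr

/-- Termwise differentiation of a power series with linearly bounded coefficients. -/
theorem hasDerivAt_tsum_mul_pow {c : ℕ → ℝ} {C z : ℝ}
    (hc : ∀ n, |c n| ≤ C * ((n : ℝ) + 1)) (hz : |z| < 1) :
    HasDerivAt (fun z => ∑' n, c n * z ^ n) (∑' n : ℕ, ((n : ℝ) + 1) * c (n + 1) * z ^ n) z := by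
  obtain ⟨r, hzr, hr⟩ := exists_between hz
  have hr0 : 0 < r := (abs_nonneg z).trans_lt hzr
  have hC : 0 ≤ C := by simpa using (abs_nonneg _).trans (hc 0)
  have hu : Summable fun n : ℕ => C * ((n : ℝ) + 1) * (n * r ^ (n - 1)) := by
    rw [← summable_nat_add_iff 1]
    refine (summable_mul_pow_of_abs_le (c := fun n : ℕ => C * ((n : ℝ) + 2) * ((n : ℝ) + 1))
      (C := 2 * C) (k := 2) (z := r) (fun n => ?_) (by rwa [abs_of_pos hr0])).congr fun n => ?_
    · rw [abs_of_nonneg (by positivity)]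
      have : 0 ≤ C * (n * (n + 1)) := by positivity
      nlinarith
    · push_cast
      ring
  have key := hasDerivAt_tsum_of_isPreconnected (t := Ioo (-r) r) (y₀ := 0) (y := z)
    (g := fun n z => c n * z ^ n) (g' := fun n z => c n * (n * z ^ (n - 1))) hu isOpen_Ioo
    isPreconnected_Ioo (fun n y _ => (hasDerivAt_pow n y).const_mul (c n)) (fun n y hy => ?_)
    ⟨by linarith, hr0⟩
    (summable_mul_pow_of_abs_le (C := C) (k := 1) (by simpa using hc) (by simp)) (abs_lt.1 hzr)
  · convert! key using 1
    have hs : Summable fun n : ℕ => c n * (n * z ^ (n - 1)) := by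
      refine Summable.of_norm_bounded hu fun n => ?_
      rw [norm_mul, norm_mul, norm_pow, Real.norm_eq_abs, Real.norm_eq_abs, Real.norm_eq_abs,
        Nat.abs_cast]
      have := hc n
      gcongr
    rw [hs.tsum_eq_zero_add]
    simp only [Nat.cast_zero, zero_mul, mul_zero, zero_add, Nat.add_sub_cancel, Nat.cast_succ]
    exact tsum_congr fun n => by ring
  · rw [norm_mul, norm_mul, norm_pow, Real.norm_eq_abs, Real.norm_eq_abs, Real.norm_eq_abs,
      Nat.abs_cast]
    have := hc n
    have : |y| ≤ r := (abs_lt.2 hy).le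
    gcongr

/-! ### The hypergeometric series with c = 1 and its differential equation -/

section Hypergeometric

variable {a b : ℝ}

theorem ordinaryHypergeometricCoefficient_one_succ (a b : ℝ) (n : ℕ) :
    ((n : ℝ) + 1) ^ 2 * ordinaryHypergeometricCoefficient a b 1 (n + 1) =
      (a + n) * (b + n) * ordinaryHypergeometricCoefficient a b 1 n := by
  have h : (n.factorial : ℝ) ≠ 0 := by positivity
  have h' : (n : ℝ) + 1 ≠ 0 := by positivity
  simp only [ordinaryHypergeometricCoefficient, ascPochhammer_succ_eval, ascPochhammer_eval_one,
    Nat.factorial_succ]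
  push_cast
  field_simp
  ring

theorem ordinaryHypergeometricCoefficient_one_nonneg (ha : 0 ≤ a) (hb : 0 ≤ b) (n : ℕ) :
    0 ≤ ordinaryHypergeometricCoefficient a b 1 n := by
  induction n with
  | zero => simp [ordinaryHypergeometricCoefficient]
  | succ n ih =>
    have h := ordinaryHypergeometricCoefficient_one_succ a b n
    have : 0 ≤ ((n : ℝ) + 1) ^ 2 * ordinaryHypergeometricCoefficient a b 1 (n + 1) := by
      rw [h]; positivity
    exact nonneg_of_mul_nonneg_right this (by positivity)

theorem ordinaryHypergeometricCoefficient_one_le_one (ha : 0 ≤ a) (hb : 0 ≤ b) (ha' : a ≤ 1)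
    (hb' : b ≤ 1) (n : ℕ) : ordinaryHypergeometricCoefficient a b 1 n ≤ 1 := by
  induction n with
  | zero => simp [ordinaryHypergeometricCoefficient]
  | succ n ih =>
    have h := ordinaryHypergeometricCoefficient_one_succ a b n
    have h0 := ordinaryHypergeometricCoefficient_one_nonneg ha hb n
    have h1 : (a + n) * (b + n) * ordinaryHypergeometricCoefficient a b 1 n ≤
        ((n : ℝ) + 1) * (n + 1) * 1 := by
      rw [add_comm a, add_comm b]
      gcongr
    have : ((n : ℝ) + 1) ^ 2 * ordinaryHypergeometricCoefficient a b 1 (n + 1) ≤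
        ((n : ℝ) + 1) ^ 2 * 1 := by rw [h]; linarith
    exact le_of_mul_le_mul_left this (by positivity)

theorem abs_ordinaryHypergeometricCoefficient_one_le (ha : 0 ≤ a) (hb : 0 ≤ b) (ha' : a ≤ 1)
    (hb' : b ≤ 1) (n : ℕ) : |ordinaryHypergeometricCoefficient a b 1 n| ≤ 1 := by
  rw [abs_of_nonneg (ordinaryHypergeometricCoefficient_one_nonneg ha hb n)]
  exact ordinaryHypergeometricCoefficient_one_le_one ha hb ha' hb' n

theorem ordinaryHypergeometric_real_eq_tsum (a b c : ℝ) :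
    ordinaryHypergeometric a b c =
      fun z : ℝ => ∑' n, ordinaryHypergeometricCoefficient a b c n * z ^ n := by
  rw [ordinaryHypergeometric_eq_tsum]
  rfl

theorem one_le_ordinaryHypergeometric_one (ha : 0 ≤ a) (hb : 0 ≤ b) (ha' : a ≤ 1)
    (hb' : b ≤ 1) {z : ℝ} (hz0 : 0 ≤ z) (hz : z < 1) : 1 ≤ ordinaryHypergeometric a b 1 z := by
  have hs : Summable fun n => ordinaryHypergeometricCoefficient a b 1 n * z ^ n :=
    summable_mul_pow_of_abs_le (C := 1) (k := 0)
      (by simpa using abs_ordinaryHypergeometricCoefficient_one_le ha hb ha' hb')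
      (by rwa [abs_of_nonneg hz0])
  rw [ordinaryHypergeometric_real_eq_tsum]
  have h := hs.le_tsum 0 fun n _ =>
    mul_nonneg (ordinaryHypergeometricCoefficient_one_nonneg ha hb n) (pow_nonneg hz0 n)
  simpa [ordinaryHypergeometricCoefficient] using h

theorem hasDerivAt_ordinaryHypergeometric_one (ha : 0 ≤ a) (hb : 0 ≤ b) (ha' : a ≤ 1)
    (hb' : b ≤ 1) {z : ℝ} (hz : |z| < 1) :
    HasDerivAt (ordinaryHypergeometric a b 1)
      (∑' n : ℕ, ((n : ℝ) + 1) * ordinaryHypergeometricCoefficient a b 1 (n + 1) * z ^ n) z := by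
  rw [ordinaryHypergeometric_real_eq_tsum]
  refine hasDerivAt_tsum_mul_pow (C := 1) (fun n => ?_) hz
  have := abs_ordinaryHypergeometricCoefficient_one_le ha hb ha' hb' n
  have : (0 : ℝ) ≤ n := n.cast_nonneg
  linarith

/-- The hypergeometric equation with `a + b = c = 1`, in self-adjoint form. -/
theorem hasDerivAt_ordinaryHypergeometric_one_selfAdjoint (ha : 0 ≤ a) (hb : 0 ≤ b)
    (hab : a + b = 1) {z : ℝ} (hz : |z| < 1) :
    HasDerivAt (fun z => z * (1 - z) * deriv (ordinaryHypergeometric a b (1 : ℝ)) z)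
      (a * b * ordinaryHypergeometric a b 1 z) z := by
  have ha' : a ≤ 1 := by linarith
  have hb' : b ≤ 1 := by linarith
  set c := ordinaryHypergeometricCoefficient a b 1 with hc_def
  have hc1 : ∀ n, |c n| ≤ 1 := abs_ordinaryHypergeometricCoefficient_one_le ha hb ha' hb'
  -- For n ≥ 1 these are the coefficients of z(1-z)F'(z). At n = 0 truncated subtraction gives d 0 =
  -- c 0 instead of 0, hence the correction `- c 0` in `hsum`.
  let d : ℕ → ℝ := fun n => n * c n - (n - 1 : ℝ) * c (n - 1)
  have hd : ∀ n, |d n| ≤ 2 * ((n : ℝ) + 1) := by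
    intro n
    have h1 : |(n : ℝ) * c n| ≤ n * 1 := by
      rw [abs_mul, Nat.abs_cast]
      exact mul_le_mul_of_nonneg_left (hc1 n) n.cast_nonneg
    have h2 : |(n - 1 : ℝ) * c (n - 1)| ≤ (n + 1) * 1 := by
      rw [abs_mul]
      refine mul_le_mul ?_ (hc1 _) (abs_nonneg _) (by positivity)
      have : (0 : ℝ) ≤ n := n.cast_nonneg
      rw [abs_le]
      constructor <;> linarith
    have := abs_sub (n * c n) ((n - 1 : ℝ) * c (n - 1))
    simp only [d]
    linarith
  have hd0 : d 0 = c 0 := by simp [d]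
  have hderiv := hasDerivAt_tsum_mul_pow hd hz
  -- (a+n)(b+n) - n(n+1) = ab + n(a+b-1), and the last term vanishes.
  have hrec : ∀ n : ℕ, ((n : ℝ) + 1) * d (n + 1) = a * b * c n := by
    intro n
    have h := ordinaryHypergeometricCoefficient_one_succ a b n
    rw [← hc_def] at h
    simp only [d, Nat.add_sub_cancel]
    push_cast
    linear_combination h + n * c n * hab
  have hsum : ∀ w : ℝ, |w| < 1 → w * (1 - w) * deriv (ordinaryHypergeometric a b (1 : ℝ)) w =
      (∑' n, d n * w ^ n) - c 0 := by
    intro w hw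
    rw [(hasDerivAt_ordinaryHypergeometric_one ha hb ha' hb' hw).deriv]
    have hs : Summable fun n : ℕ => (n : ℝ) * c n * w ^ n := by
      refine summable_mul_pow_of_abs_le (C := 1) (k := 1) (fun n => ?_) hw
      rw [abs_mul, Nat.abs_cast]
      have := mul_le_mul_of_nonneg_left (hc1 n) (n.cast_nonneg (α := ℝ))
      linarith
    have hsd : Summable fun n => d n * w ^ n :=
      summable_mul_pow_of_abs_le (C := 2) (k := 1) (by simpa using hd) hw
    have e1 : (∑' n : ℕ, ((n : ℝ) + 1) * c (n + 1) * w ^ n) * w =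
        ∑' n : ℕ, (n : ℝ) * c n * w ^ n := by
      rw [hs.tsum_eq_zero_add, ← tsum_mul_right]
      simp [pow_succ, mul_assoc]
    have e2 : (∑' n, d n * w ^ n) - c 0 =
        (∑' n : ℕ, (n : ℝ) * c n * w ^ n) - (∑' n : ℕ, (n : ℝ) * c n * w ^ n) * w := by
      conv_rhs => rw [← tsum_mul_right, hs.tsum_eq_zero_add]
      rw [hsd.tsum_eq_zero_add, hd0]
      have hs' := (summable_nat_add_iff 1).2 hs
      simp only [Nat.cast_zero, zero_mul, zero_add, pow_zero, mul_one, add_sub_cancel_left]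
      rw [← Summable.tsum_sub hs' (hs.mul_right w)]
      refine tsum_congr fun n => ?_
      simp only [d, Nat.add_sub_cancel]
      push_cast
      ring
    rw [e2, ← e1]
    ring
  have hfin := hderiv.sub_const (c 0)
  have hval : (∑' n : ℕ, ((n : ℝ) + 1) * d (n + 1) * z ^ n) =
      a * b * ordinaryHypergeometric a b 1 z := by
    rw [ordinaryHypergeometric_real_eq_tsum, ← tsum_mul_left]
    exact tsum_congr fun n => by rw [hrec, mul_assoc]
  rw [hval] at hfin
  refine hfin.congr_of_eventuallyEq ?_
  filter_upwards [(continuous_abs.isOpen_preimage _ isOpen_Iio).mem_nhds hz] with w hw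
  exact hsum w hw

end Hypergeometric

/-- Two solutions on `(0, 1)` of `(s w')' = k w` with `s > 0`, regular at `0` with the same value
there and one of them positive, agree. Here `p = s u'` and `r = s v'`. -/
theorem eq_of_selfAdjoint_equation {s k u v p r : ℝ → ℝ}
    (hs : ∀ x ∈ Ioo (0 : ℝ) 1, 0 < s x)
    (hu : ∀ x ∈ Ioo (0 : ℝ) 1, HasDerivAt u (p x / s x) x)
    (hv : ∀ x ∈ Ioo (0 : ℝ) 1, HasDerivAt v (r x / s x) x)
    (hp : ∀ x ∈ Ioo (0 : ℝ) 1, HasDerivAt p (k x * u x) x)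
    (hr : ∀ x ∈ Ioo (0 : ℝ) 1, HasDerivAt r (k x * v x) x)
    (hu0 : ContinuousAt u 0) (hv0 : ContinuousAt v 0) (hp0 : ContinuousAt p 0)
    (hr0 : ContinuousAt r 0) (hp00 : p 0 = 0) (hr00 : r 0 = 0) (huv : v 0 = u 0)
    (hpos : ∀ x ∈ Ico (0 : ℝ) 1, 0 < u x) {x : ℝ} (hx : x ∈ Ioo (0 : ℝ) 1) : v x = u x := by
  have const : ∀ f : ℝ → ℝ, (∀ y ∈ Ioo (0 : ℝ) 1, HasDerivAt f 0 y) → ContinuousAt f 0 →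
      ∀ y ∈ Ioo (0 : ℝ) 1, f y = f 0 := by
    intro f hf hf0 y hy
    have hcont : ContinuousOn f (Icc 0 y) := fun w hw => by
      rcases hw.1.eq_or_lt with rfl | h
      · exact hf0.continuousWithinAt
      · exact (hf w ⟨h, hw.2.trans_lt hy.2⟩).continuousAt.continuousWithinAt
    obtain ⟨w, hw, h⟩ := exists_hasDerivAt_eq_slope f (fun _ => 0) hy.1 hcont
      fun w hw => hf w ⟨hw.1, hw.2.trans hy.2⟩
    have : y - 0 ≠ 0 := by simpa using hy.1.ne'
    field_simp at h
    linarith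
  -- This is s times the Wronskian: in its derivative the terms k u v cancel, and so do the terms p
  -- r / s. Then (v/u)' = 0.
  have hW : ∀ y ∈ Ioo (0 : ℝ) 1, r y * u y - v y * p y = 0 := by
    intro y hy
    have := const (fun y => r y * u y - v y * p y) (fun w hw => ?_)
      ((hr0.mul hu0).sub (hv0.mul hp0)) y hy
    · simpa [hp00, hr00] using this
    · refine (((hr w hw).mul (hu w hw)).sub ((hv w hw).mul (hp w hw))).congr_deriv ?_
      ring
  have h0 : u 0 ≠ 0 := (hpos 0 ⟨le_rfl, zero_lt_one⟩).ne'
  have := const (fun y => v y / u y) (fun w hw => ?_) (hv0.div hu0 h0) x hx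
  · have hux := (hpos x ⟨hx.1.le, hx.2⟩).ne'
    simp only [huv, div_self h0] at this
    field_simp at this
    exact this
  · refine ((hv w hw).div (hu w hw) (hpos w ⟨hw.1.le, hw.2⟩).ne').congr_deriv ?_
    have h1 := (hs w hw).ne'
    have : r w / s w * u w - v w * (p w / s w) = (r w * u w - v w * p w) / s w := by
      ring
    rw [this, hW w hw]
    simp

/-! ### The multiplier and the explicit modulus -/

/-- The fourth root of `1 - x + x ^ 2`. -/
noncomputable def sexticMultiplier (x : ℝ) : ℝ := (1 - x + x ^ 2) ^ (1 / 4 : ℝ)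

theorem one_sub_add_sq_pos (x : ℝ) : 0 < 1 - x + x ^ 2 := by nlinarith [sq_nonneg (x - 1 / 2)]

theorem sexticMultiplier_pos (x : ℝ) : 0 < sexticMultiplier x :=
  Real.rpow_pos_of_pos (one_sub_add_sq_pos x) _

theorem sexticMultiplier_pow_four (x : ℝ) : sexticMultiplier x ^ 4 = 1 - x + x ^ 2 := by
  rw [sexticMultiplier, ← Real.rpow_natCast, ← Real.rpow_mul (one_sub_add_sq_pos x).le]
  norm_num

theorem sexticMultiplier_zero : sexticMultiplier 0 = 1 := by simp [sexticMultiplier]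

theorem sexticMultiplier_one : sexticMultiplier 1 = 1 := by simp [sexticMultiplier]

theorem hasDerivAt_sexticMultiplier (x : ℝ) :
    HasDerivAt sexticMultiplier ((2 * x - 1) / (4 * sexticMultiplier x ^ 3)) x := by
  have hP : HasDerivAt (fun x : ℝ => 1 - x + x ^ 2) (2 * x - 1) x := by
    refine (((hasDerivAt_id x).const_sub 1).add (hasDerivAt_pow 2 x)).congr_deriv ?_
    push_cast
    ring
  refine (hP.rpow_const (p := 1 / 4) (Or.inl (one_sub_add_sq_pos x).ne')).congr_deriv ?_
  have h3 : (1 - x + x ^ 2) ^ ((1 : ℝ) / 4 - 1) * sexticMultiplier x ^ 3 = 1 := by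
    rw [sexticMultiplier, ← Real.rpow_mul_natCast (one_sub_add_sq_pos x).le,
      ← Real.rpow_add (one_sub_add_sq_pos x)]
    norm_num
  have := sexticMultiplier_pos x
  rw [eq_div_iff (by positivity)]
  linear_combination (2 * x - 1) * h3

/-- The explicit solution of the modular equation on the whole line. -/
noncomputable def sexticModulus (x : ℝ) : ℝ :=
  1 / 2 - (2 + x - x ^ 2) * (1 - 2 * x) / (4 * sexticMultiplier x ^ 6)

theorem sexticModulus_zero : sexticModulus 0 = 0 := by
  norm_num [sexticModulus, sexticMultiplier_zero]

theorem sexticModulus_one : sexticModulus 1 = 1 := by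
  norm_num [sexticModulus, sexticMultiplier_one]

/-- Since 4ξ(1-ξ) = 1 - (1-2ξ)², this rests on 4(1-x+x²)³ - ((2+x-x²)(1-2x))² = 27x²(1-x)². -/
theorem sexticModulus_mul_one_sub (x : ℝ) :
    sexticModulus x * (1 - sexticModulus x) =
      27 / 16 * (x * (1 - x)) ^ 2 / sexticMultiplier x ^ 12 := by
  have h := (sexticMultiplier_pos x).ne'
  have h4 := sexticMultiplier_pow_four x
  have h12 : sexticMultiplier x ^ 12 = (1 - x + x ^ 2) ^ 3 := by rw [← h4]; ring
  simp only [sexticModulus]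
  field_simp
  linear_combination 256 * h12

theorem hasDerivAt_sexticModulus (x : ℝ) :
    HasDerivAt sexticModulus (27 / 8 * (x * (1 - x)) / sexticMultiplier x ^ 10) x := by
  have h := (sexticMultiplier_pos x).ne'
  have h4 := sexticMultiplier_pow_four x
  have hN : HasDerivAt (fun x : ℝ => (2 + x - x ^ 2) * (1 - 2 * x)) (6 * x ^ 2 - 6 * x - 3) x := by
    refine ((((hasDerivAt_id x).const_add 2).sub (hasDerivAt_pow 2 x)).mul
      (((hasDerivAt_id x).const_mul 2).const_sub 1)).congr_deriv ?_
    simp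
    ring
  refine ((hN.div (((hasDerivAt_sexticMultiplier x).pow 6).const_mul 4)
    (by simpa using h)).const_sub (1 / 2)).congr_deriv ?_
  simp only [Pi.pow_apply]
  field_simp
  push_cast
  generalize sexticMultiplier x = t at *
  linear_combination -(6 * x * (x - 1) - 3) * 32 * t ^ 5 * h4

theorem continuous_sexticModulus : Continuous sexticModulus :=
  continuous_iff_continuousAt.2 fun x => (hasDerivAt_sexticModulus x).continuousAt

theorem sexticModulus_strictMonoOn : StrictMonoOn sexticModulus (Icc 0 1) := by
  refine strictMonoOn_of_deriv_pos (convex_Icc 0 1) continuous_sexticModulus.continuousOn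
    fun x hx => ?_
  rw [interior_Icc] at hx
  rw [(hasDerivAt_sexticModulus x).deriv]
  have := sexticMultiplier_pos x
  have := mul_pos hx.1 (sub_pos.2 hx.2)
  positivity

theorem sexticModulus_mem_Ioo {x : ℝ} (hx : x ∈ Ioo (0 : ℝ) 1) :
    sexticModulus x ∈ Ioo (0 : ℝ) 1 := by
  have h0 := sexticModulus_strictMonoOn (by simp) (Ioo_subset_Icc_self hx) hx.1
  have h1 := sexticModulus_strictMonoOn (Ioo_subset_Icc_self hx) (by simp) hx.2
  rw [sexticModulus_zero] at h0
  rw [sexticModulus_one] at h1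
  exact ⟨h0, h1⟩

theorem isSexticModulusMap_sexticModulus :
    IsSexticModulusMap fun x => ⟨sexticModulus x, sexticModulus_mem_Ioo x.2⟩ where
  strictMono x y hxy := Subtype.mk_lt_mk.2 <| sexticModulus_strictMonoOn
    (Ioo_subset_Icc_self x.2) (Ioo_subset_Icc_self y.2) hxy
  bijective := by
    refine ⟨fun x y hxy => Subtype.ext <| sexticModulus_strictMonoOn.injOn
      (Ioo_subset_Icc_self x.2) (Ioo_subset_Icc_self y.2) (by simpa using hxy), fun y => ?_⟩
    obtain ⟨x, hx, hxy⟩ := intermediate_value_Ioo zero_le_one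
      continuous_sexticModulus.continuousOn
      (by rw [sexticModulus_zero, sexticModulus_one]; exact y.2)
    exact ⟨⟨x, hx⟩, Subtype.ext hxy⟩
  modular_eq x := by
    have h := sexticModulus_mul_one_sub x
    have h12 : sexticMultiplier x ^ 12 = (1 - (x : ℝ) + (x : ℝ) ^ 2) ^ 3 := by
      rw [← sexticMultiplier_pow_four]; ring
    rw [h12] at h
    simp only [mul_assoc, h]
    ring

theorem IsSexticModulusMap.apply_half {ξ : Ioo (0 : ℝ) 1 → Ioo (0 : ℝ) 1}
    (h : IsSexticModulusMap ξ) :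
    (ξ ⟨1 / 2, by norm_num, by norm_num⟩ : ℝ) = 1 / 2 := by
  have := h.modular_eq ⟨1 / 2, by norm_num, by norm_num⟩
  norm_num at this
  nlinarith

/-- Equal ξ(1-ξ) leaves only η = ξ or η = 1-ξ. At x = 1/2 the right side of the modular equation is
1, which forces the value 1/2; monotonicity then keeps both maps on the same side of 1/2, excluding
the reflection. -/
theorem IsSexticModulusMap.eq {ξ η : Ioo (0 : ℝ) 1 → Ioo (0 : ℝ) 1}
    (hξ : IsSexticModulusMap ξ) (hη : IsSexticModulusMap η) : ξ = η := by
  ext x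
  have h : (ξ x : ℝ) * (1 - ξ x) = η x * (1 - η x) := by
    have h1 := hξ.modular_eq x
    have h2 := hη.modular_eq x
    linarith
  have h' : ((ξ x : ℝ) - η x) * (1 - ξ x - η x) = 0 := by linear_combination h
  rcases mul_eq_zero.1 h' with h' | h'
  · linarith
  · have hξ2 := hξ.apply_half
    have hη2 := hη.apply_half
    rcases lt_trichotomy x ⟨1 / 2, by norm_num, by norm_num⟩ with hx | hx | hx
    · have h1 := Subtype.coe_lt_coe.2 (hξ.strictMono hx)
      have h2 := Subtype.coe_lt_coe.2 (hη.strictMono hx)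
      linarith
    · rw [hx, hξ2, hη2]
    · have h1 := Subtype.coe_lt_coe.2 (hξ.strictMono hx)
      have h2 := Subtype.coe_lt_coe.2 (hη.strictMono hx)
      linarith

/-! ### The transformation formula -/

theorem ordinaryHypergeometric_sexticModulus {x : ℝ} (hx : x ∈ Ioo (0 : ℝ) 1) :
    ordinaryHypergeometric (1 / 6 : ℝ) (5 / 6 : ℝ) (1 : ℝ) (sexticModulus x) =
      sexticMultiplier x * ordinaryHypergeometric (1 / 2 : ℝ) (1 / 2 : ℝ) (1 : ℝ) x := by
  set F : ℝ → ℝ := ordinaryHypergeometric (1 / 6 : ℝ) (5 / 6 : ℝ) (1 : ℝ) with hF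
  set K : ℝ → ℝ := ordinaryHypergeometric (1 / 2 : ℝ) (1 / 2 : ℝ) (1 : ℝ) with hK
  set q : ℝ → ℝ := fun z => z * (1 - z) * deriv F z with hq
  have hF1 : ∀ z : ℝ, |z| < 1 → HasDerivAt F (deriv F z) z := fun z hz =>
    (hasDerivAt_ordinaryHypergeometric_one (by norm_num) (by norm_num) (by norm_num) (by norm_num)
      hz).differentiableAt.hasDerivAt
  have hK1 : ∀ z : ℝ, |z| < 1 → HasDerivAt K (deriv K z) z := fun z hz =>
    (hasDerivAt_ordinaryHypergeometric_one (by norm_num) (by norm_num) (by norm_num) (by norm_num)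
      hz).differentiableAt.hasDerivAt
  have hF2 : ∀ z : ℝ, |z| < 1 → HasDerivAt q (5 / 36 * F z) z := fun z hz =>
    (hasDerivAt_ordinaryHypergeometric_one_selfAdjoint (by norm_num) (by norm_num) (by norm_num)
      hz).congr_deriv (by rw [hF]; norm_num)
  have hK2 : ∀ z : ℝ, |z| < 1 →
      HasDerivAt (fun z => z * (1 - z) * deriv K z) (1 / 4 * K z) z := fun z hz =>
    (hasDerivAt_ordinaryHypergeometric_one_selfAdjoint (by norm_num) (by norm_num) (by norm_num)
      hz).congr_deriv (by rw [hK]; norm_num)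
  have habs : ∀ y ∈ Ioo (0 : ℝ) 1, |y| < 1 := fun y hy => by rw [abs_of_pos hy.1]; exact hy.2
  have hF0 : ContinuousAt F (sexticModulus 0) := by
    rw [sexticModulus_zero]; exact (hF1 0 (by simp)).continuousAt
  have hq0 : ContinuousAt q (sexticModulus 0) := by
    rw [sexticModulus_zero]; exact (hF2 0 (by simp)).continuousAt
  have hFξ := hF0.comp continuous_sexticModulus.continuousAt
  have hqξ := hq0.comp continuous_sexticModulus.continuousAt
  have hT0 := (hasDerivAt_sexticMultiplier 0).continuousAt
  have hT00 := (sexticMultiplier_pos 0).ne'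
  have key := eq_of_selfAdjoint_equation (s := fun x => x * (1 - x)) (k := fun _ => 1 / 4) (u := K)
    (v := fun x => F (sexticModulus x) / sexticMultiplier x)
    (p := fun x => x * (1 - x) * deriv K x)
    -- This is x(1-x)v', with x(1-x)ξ'/T rewritten as 2Tξ(1-ξ); the result is continuous at 0
    -- because `q` is.
    (r := fun x => (1 - 2 * x) * (x * (1 - x)) / (4 * sexticMultiplier x ^ 5) * F (sexticModulus x)
      + 2 * sexticMultiplier x * q (sexticModulus x))
    (fun y hy => mul_pos hy.1 (sub_pos.2 hy.2)) (fun y hy => ?_) (fun y hy => ?_)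
    (fun y hy => hK2 y (habs y hy)) (fun y hy => ?_) (hK1 0 (by simp)).continuousAt
    (hFξ.div hT0 hT00) (hK2 0 (by simp)).continuousAt
    (((((by fun_prop : Continuous fun x : ℝ => (1 - 2 * x) * (x * (1 - x))).continuousAt).div
      (continuousAt_const.mul (hT0.pow 5)) (by simpa using hT00)).mul hFξ).add
      ((continuousAt_const.mul hT0).mul hqξ))
    (by simp) (by simp [sexticModulus_zero, hq])
    (by simp [sexticModulus_zero, sexticMultiplier_zero, hF, hK])
    (fun y hy => zero_lt_one.trans_le <| one_le_ordinaryHypergeometric_one (by norm_num)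
      (by norm_num) (by norm_num) (by norm_num) hy.1 hy.2) hx
  · have := (sexticMultiplier_pos x).ne'
    field_simp at key
    rw [key]
  · have := (mul_pos hy.1 (sub_pos.2 hy.2)).ne'
    exact (hK1 y (habs y hy)).congr_deriv (mul_div_cancel_left₀ _ this).symm
  · have hs := (mul_pos hy.1 (sub_pos.2 hy.2)).ne'
    have hy0 := hy.1.ne'
    have hy1 := (sub_pos.2 hy.2).ne'
    have hT := (sexticMultiplier_pos y).ne'
    have hd := (hF1 _ (habs _ (sexticModulus_mem_Ioo hy))).comp y (hasDerivAt_sexticModulus y)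
    refine (hd.div (hasDerivAt_sexticMultiplier y) hT).congr_deriv ?_
    simp only [Function.comp_apply, hq, sexticModulus_mul_one_sub]
    field_simp
    ring
  · have hs := (mul_pos hy.1 (sub_pos.2 hy.2)).ne'
    have hy0 := hy.1.ne'
    have hy1 := (sub_pos.2 hy.2).ne'
    have hT := (sexticMultiplier_pos y).ne'
    have hTd := hasDerivAt_sexticMultiplier y
    have h4 := sexticMultiplier_pow_four y
    have hd := (hF1 _ (habs _ (sexticModulus_mem_Ioo hy))).comp y (hasDerivAt_sexticModulus y)
    have hqd := (hF2 _ (habs _ (sexticModulus_mem_Ioo hy))).comp y (hasDerivAt_sexticModulus y)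
    have hN : HasDerivAt (fun x : ℝ => (1 - 2 * x) * (x * (1 - x))) (1 - 6 * y + 6 * y ^ 2) y := by
      refine ((((hasDerivAt_id y).const_mul 2).const_sub 1).mul
        ((hasDerivAt_id y).mul ((hasDerivAt_id y).const_sub 1))).congr_deriv ?_
      simp
      ring
    refine (((hN.div ((hTd.pow 5).const_mul 4) (by simpa using hT)).mul hd).add
      ((hTd.const_mul 2).mul hqd)).congr_deriv ?_
    simp only [Function.comp_apply, hq, sexticModulus_mul_one_sub, Pi.pow_apply, Pi.div_apply]
    generalize deriv F (sexticModulus y) = D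
    generalize F (sexticModulus y) = G
    generalize sexticMultiplier y = t at *
    field_simp
    push_cast
    -- The terms in D cancel identically; the coefficient of G matches 1/(4t) modulo t⁴ = 1 - y +
    -- y².
    linear_combination
      18432 * G * t ^ 6 * ((1 - 6 * y + 6 * y ^ 2) - (t ^ 4 + (1 - y + y ^ 2))) * h4

theorem theorem8 :
    (∃! ξ : Set.Ioo (0 : ℝ) 1 → Set.Ioo (0 : ℝ) 1, IsSexticModulusMap ξ) ∧
      ∀ ξ : Set.Ioo (0 : ℝ) 1 → Set.Ioo (0 : ℝ) 1, IsSexticModulusMap ξ →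
        ∀ x : Set.Ioo (0 : ℝ) 1,
          ordinaryHypergeometric (1 / 6 : ℝ) (5 / 6 : ℝ) (1 : ℝ) (ξ x : ℝ) =
            (1 - (x : ℝ) + (x : ℝ) ^ 2) ^ (1 / 4 : ℝ) *
              ordinaryHypergeometric (1 / 2 : ℝ) (1 / 2 : ℝ) (1 : ℝ) (x : ℝ) := by
  refine ⟨⟨_, isSexticModulusMap_sexticModulus,
    fun ξ hξ => hξ.eq isSexticModulusMap_sexticModulus⟩, fun ξ hξ x => ?_⟩
  rw [hξ.eq isSexticModulusMap_sexticModulus]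
  exact ordinaryHypergeometric_sexticModulus x.2
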